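/- Let $C$ be a smooth projective (integral) curve over $\mathbb{C}$ with a fixed closed embedding $C\subseteq\mathbb{P}^N$, with respect to which Hilbert polynomials are taken. For $P\in\mathbb{Q}[t]$ let $\mathrm{Hilb}_C^P$ be the Hilbert scheme parametrizing the nonempty closed subschemes of $C$ with Hilbert polynomial $P$ (so that $\mathrm{Hilb}_C^0=\emptyset$). A finite family $(P_1,\dots,P_s)$ of polynomials in $\mathbb{Q}[t]$ is called a good partition of $P$ if $\sum_{i=1}^s P_i=P$ and $\mathrm{Hilb}_C^{P_i}\neq\emptyset$ for all $i$. A partition of a positive integer $n$ is a tuple $(n_1,\dots,n_s)$ of positive integers with $\sum_{i=1}^s n_i=n$. Let $n$ be a positive integer, and view integers as constant polynomials. Then every partition of $n$ is a good partition of $n$, and conversely every good partition of $n$ is a partition of $n$ (in particular, all its members are constant polynomials given by positive integers). Moreover, for an integer $k$, the Hilbert scheme $\mathrm{Hilb}_C^k$ is nonempty if and only if $k>0$. -/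

import Mathlib

open CategoryTheory CategoryTheory.Limits AlgebraicGeometry

noncomputable section

namespace HilbertCurve

/-! ### Projective space over the complex numbers -/

/-- The standard grading of `ℂ[x₀, …, x_N]` by degree. -/
abbrev grading (N : ℕ) : ℕ → Submodule ℂ (MvPolynomial (Fin (N + 1)) ℂ) :=
  MvPolynomial.homogeneousSubmodule (Fin (N + 1)) ℂ

instance (N : ℕ) : GradedAlgebra (grading N) := MvPolynomial.gradedAlgebra

/-- Projective space `ℙ^N = Proj ℂ[x₀, …, x_N]`. -/
abbrev ProjSpace (N : ℕ) : Scheme.{0} := Proj (grading N)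

/-- The structure morphism `ℙ^N ⟶ Spec ℂ`. -/
def ProjSpace.toSpec (N : ℕ) : ProjSpace N ⟶ Spec (.of ℂ) :=
  Proj.toSpecZero (grading N) ≫ Spec.map (CommRingCat.ofHom (algebraMap ℂ (grading N 0)))

/-- The standard chart `D₊(xᵢ)` of `ℙ^N`. -/
abbrev chart {N : ℕ} (i : Fin (N + 1)) : (ProjSpace N).Opens :=
  Proj.basicOpen (grading N) (MvPolynomial.X i)

theorem X_mem_grading {N : ℕ} (i : Fin (N + 1)) :
    (MvPolynomial.X i : MvPolynomial (Fin (N + 1)) ℂ) ∈ grading N 1 :=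
  (MvPolynomial.mem_homogeneousSubmodule 1 _).2 (MvPolynomial.isHomogeneous_X ℂ i)

/-- The regular function `xⱼ / xᵢ` on the chart `D₊(xᵢ)`. -/
def coordRatio {N : ℕ} (j i : Fin (N + 1)) : Γ(ProjSpace N, chart i) :=
  (Proj.awayToSection (grading N) (MvPolynomial.X i)).hom
    (HomogeneousLocalization.Away.mk (grading N) (X_mem_grading i) 1
      (MvPolynomial.X j) (by rw [one_smul]; exact X_mem_grading j))

/-! ### Hilbert polynomials of closed subschemes of projective space -/

section HilbertPolynomial

variable {K : Type} [Field K] {N : ℕ} {Z : Scheme.{0}}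

/-- For a `K`-scheme `g : Z ⟶ Spec K` and an open `U` of `Z`, the ring homomorphism
`K → Γ(Z, U)` making `Γ(Z, U)` a `K`-algebra. -/
def scalarMap (g : Z ⟶ Spec (.of K)) (U : Z.Opens) : K →+* Γ(Z, U) :=
  ((Scheme.ΓSpecIso (.of K)).inv ≫ g.appLE ⊤ U le_top).hom

/-- Let `Z` be a `K`-scheme with a morphism `φ` to `ℙ^N`. The dehomogenization of a polynomial
`F ∈ K[x₀, …, x_N]` with respect to `xᵢ`, pulled back to `Z`: it is the function
`F(x₀ / xᵢ, …, x_N / xᵢ)` on the open subset `φ⁻¹ D₊(xᵢ)` of `Z`. If `F` is a form of degree `t`,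
this is `F / xᵢ ^ t`. -/
def restrictToChart (g : Z ⟶ Spec (.of K)) (φ : Z ⟶ ProjSpace N) (i : Fin (N + 1)) :
    MvPolynomial (Fin (N + 1)) K →+* Γ(Z, φ ⁻¹ᵁ chart i) :=
  MvPolynomial.eval₂Hom (scalarMap g (φ ⁻¹ᵁ chart i)) fun j ↦ (φ.app (chart i)).hom (coordRatio j i)

/-- The degree `t` part `I(Z)_t` of the saturated homogeneous ideal of `Z` in `K[x₀, …, x_N]`:
the forms of degree `t` with coefficients in `K` that vanish on `Z`. -/
def vanishingForms (g : Z ⟶ Spec (.of K)) (φ : Z ⟶ ProjSpace N) (t : ℕ) :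
    Submodule K (MvPolynomial.homogeneousSubmodule (Fin (N + 1)) K t) where
  carrier := {F | ∀ i, restrictToChart g φ i (F : MvPolynomial (Fin (N + 1)) K) = 0}
  zero_mem' i := by simp
  add_mem' {F G} hF hG i := by simp [hF i, hG i]
  smul_mem' a F hF i := by simp [MvPolynomial.smul_eq_C_mul, hF i]

/-- The Hilbert function `t ↦ dim_K (K[x₀, …, x_N] / I(Z))_t` of `Z`. It is meant for `Z` a
closed subscheme of `ℙ^N_K`, given by its structure morphism `g` to `Spec K` and the composite
`φ` of the inclusion into `ℙ^N_K = ℙ^N × Spec K` with the projection to `ℙ^N`. -/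
def hilbertFunction (g : Z ⟶ Spec (.of K)) (φ : Z ⟶ ProjSpace N) (t : ℕ) : ℕ :=
  Module.finrank K
    (MvPolynomial.homogeneousSubmodule (Fin (N + 1)) K t ⧸ vanishingForms g φ t)

/-- `P` is the Hilbert polynomial of `Z`: it agrees with the Hilbert function in all large
degrees. -/
def HasHilbertPolynomial (g : Z ⟶ Spec (.of K)) (φ : Z ⟶ ProjSpace N)
    (P : Polynomial ℚ) : Prop :=
  ∀ᶠ t : ℕ in Filter.atTop, (hilbertFunction g φ t : ℚ) = P.eval (t : ℚ)

end HilbertPolynomial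

/-! ### Curves -/

/-- A smooth projective (integral) curve over `ℂ`, with a projective embedding; the embedding is
what Hilbert polynomials on the curve refer to. -/
structure SmoothProjectiveCurve where
  /-- the underlying scheme -/
  X : Scheme.{0}
  /-- the dimension of the ambient projective space -/
  N : ℕ
  /-- the projective embedding -/
  ι : X ⟶ ProjSpace N
  isClosedImmersion : IsClosedImmersion ι
  isIntegral : IsIntegral X
  smooth : Smooth (ι ≫ ProjSpace.toSpec N)
  dim_eq_one : topologicalKrullDim X = 1

namespace SmoothProjectiveCurve

variable (C : SmoothProjectiveCurve)

/-- The structure morphism `C ⟶ Spec ℂ`. -/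
def str : C.X ⟶ Spec (.of ℂ) := C.ι ≫ ProjSpace.toSpec C.N

/-- The product `C × S` over `ℂ`, for a `ℂ`-scheme `σ : S ⟶ Spec ℂ`. -/
abbrev prod {S : Scheme.{0}} (σ : S ⟶ Spec (.of ℂ)) : Scheme.{0} := pullback C.str σ

/-- The morphism `id × f : C × T ⟶ C × S` induced by a morphism `f : T ⟶ S` of `ℂ`-schemes. -/
def prodMap {S T : Scheme.{0}} {σ : S ⟶ Spec (.of ℂ)} {τ : T ⟶ Spec (.of ℂ)} (f : T ⟶ S)
    (hf : f ≫ σ = τ) : C.prod τ ⟶ C.prod σ :=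
  pullback.map C.str τ C.str σ (𝟙 _) f (𝟙 _) (by simp) (by simp [hf])

/-! ### The Hilbert scheme through its functor of points -/

section Family

variable {S : Scheme.{0}} {σ : S ⟶ Spec (.of ℂ)} (I : (C.prod σ).IdealSheafData)

/-- The projection to `S` of the closed subscheme `Z ⊆ C × S` with ideal sheaf `I`. -/
def familyMap : I.subscheme ⟶ S := I.subschemeι ≫ pullback.snd C.str σ

/-- The fibre `Z_s` of the closed subscheme `Z ⊆ C × S` with ideal sheaf `I` over a point `s` of
`S`. It is a closed subscheme of `C × Spec κ(s)`. -/
def fibre (s : S) : Scheme.{0} := (C.familyMap I).fiber s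

/-- The structure morphism `Z_s ⟶ Spec κ(s)`. -/
def fibreStr (s : S) : C.fibre I s ⟶ Spec (.of (S.residueField s)) :=
  (C.familyMap I).fiberToSpecResidueField s

/-- The morphism `Z_s ⟶ C × Spec κ(s) ⟶ C ⟶ ℙ^N`. -/
def fibreToProjSpace (s : S) : C.fibre I s ⟶ ProjSpace C.N :=
  (C.familyMap I).fiberι s ≫ I.subschemeι ≫ pullback.fst C.str σ ≫ C.ι

/-- The families of nonempty closed subschemes of `C` with Hilbert polynomial `P` parametrized by
a `ℂ`-scheme `S`: the closed subschemes of `C × S` that are flat over `S` and all whose fibres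
over points of `S` are nonempty and have Hilbert polynomial `P`. -/
structure IsHilbertFamily (P : Polynomial ℚ) : Prop where
  flat : Flat (C.familyMap I)
  nonempty_fibre : ∀ s : S, Nonempty (C.fibre I s)
  hasHilbertPolynomial : ∀ s : S,
    HasHilbertPolynomial (C.fibreStr I s) (C.fibreToProjSpace I s) P

end Family

/-- The `ℂ`-scheme `η : H ⟶ Spec ℂ` is the Hilbert scheme `Hilb_C^P`: it is locally noetherian and
represents the functor that sends a locally noetherian `ℂ`-scheme to the set of families of
nonempty closed subschemes of `C` with Hilbert polynomial `P` parametrized by it, that is, it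
carries a universal such family. -/
def IsHilbertScheme (P : Polynomial ℚ) {H : Scheme.{0}} (η : H ⟶ Spec (.of ℂ)) : Prop :=
  IsLocallyNoetherian H ∧ ∃ U : (C.prod η).IdealSheafData, C.IsHilbertFamily U P ∧
    ∀ (T : Scheme.{0}) (τ : T ⟶ Spec (.of ℂ)), IsLocallyNoetherian T →
      ∀ I : (C.prod τ).IdealSheafData, C.IsHilbertFamily I P →
        ∃! f : T ⟶ H, ∃ hf : f ≫ η = τ, U.comap (C.prodMap f hf) = I

/-- `Hilb_C^P ≠ ∅`, expressed through the functor of points of the Hilbert scheme: over some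
nonempty (locally noetherian) `ℂ`-scheme `S` there is a family of closed subschemes of `C` with
Hilbert polynomial `P`, in other words there is a morphism from a nonempty scheme to the Hilbert
scheme. -/
def HilbNonempty (P : Polynomial ℚ) : Prop :=
  ∃ (S : Scheme.{0}) (σ : S ⟶ Spec (.of ℂ)) (I : (C.prod σ).IdealSheafData),
    IsLocallyNoetherian S ∧ Nonempty S ∧ C.IsHilbertFamily I P

/-- `HilbNonempty` says that the Hilbert scheme, as a scheme, is nonempty. -/
theorem hilbNonempty_iff {P : Polynomial ℚ} {H : Scheme.{0}} {η : H ⟶ Spec (.of ℂ)}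
    (h : C.IsHilbertScheme P η) : C.HilbNonempty P ↔ Nonempty H := by
  obtain ⟨hH, U, hU, huniv⟩ := h
  constructor
  · rintro ⟨S, σ, I, hS, ⟨s⟩, hI⟩
    obtain ⟨f, -, -⟩ := huniv S σ hS I hI
    exact ⟨f s⟩
  · exact fun hne ↦ ⟨H, η, U, hH, hne, hU⟩

/-! ### Partitions and good partitions -/

/-- A finite family `(P₁, …, P_s)` of polynomials with rational coefficients is a good partition
of `P` if its sum is `P` and `Hilb_C^{P_i}` is nonempty for every `i`. -/
def IsGoodPartition (P : Polynomial ℚ) {s : ℕ} (Q : Fin s → Polynomial ℚ) : Prop :=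
  ∑ i, Q i = P ∧ ∀ i, C.HilbNonempty (Q i)

end SmoothProjectiveCurve

/-- A partition of `n` of length `s`: an `s`-tuple of positive integers with sum `n`. -/
def IsPartition (n : ℕ) {s : ℕ} (m : Fin s → ℕ) : Prop :=
  ∑ i, m i = n ∧ ∀ i, 0 < m i

/-- An integer viewed as a constant polynomial with rational coefficients. -/
def constPoly (k : ℤ) : Polynomial ℚ := Polynomial.C (k : ℚ)

end HilbertCurve

end

/-! A nonempty closed subscheme has positive Hilbert function, because `xᵢ ^ t` does not vanish at a
point of `D₊(xᵢ)` (`hilbertFunction_pos`). So if `Hilb_C^P` is nonempty, `P(t)` is a positive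
integer for all large `t`; for constant `P = k` this says `k > 0`. In a good partition of `n` these
values add up to `n`, so every member is bounded on large integers, hence constant
(`eq_C_of_eventually_eval_mem_Icc`), hence a positive integer.

Conversely, `C` has infinitely many closed points, and any `n` of them with the reduced structure
form a family over `Spec ℂ`, flat because the base is a field. For large `t`, evaluation at these
points maps the forms of degree `t` onto `K ^ n`, since forms separate the points; by reducedness
its kernel consists of the vanishing forms. So the Hilbert polynomial is `n`
(`eventually_hilbertFunction_eq_card`).

Hilbert functions are taken over residue fields of the base, whereas `ℙ^N` lives over `ℂ`; the
lemmas therefore carry a compatible homomorphism `c : ℂ →+* K`. -/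

noncomputable section

namespace HilbertCurve

/-! ### Scalars acting on sections and on residue fields -/

section ScalarMap

variable {K : Type} [Field K] {Z : Scheme.{0}}

theorem scalarMap_eq (g : Z ⟶ Spec (.of K)) (U : Z.Opens) :
    scalarMap g U = ((Scheme.ΓSpecIso (.of K)).inv ≫ g.appTop ≫
      Z.presheaf.map (homOfLE (le_top : U ≤ ⊤)).op).hom := rfl

/-- A morphism to an affine scheme is determined by its effect on global sections. This computes
scalars on a chart of `Proj`, where the structure morphism is known only as such a factorization. -/
theorem scalarMap_eq_of_ι_comp_eq {g : Z ⟶ Spec (.of K)} {U : Z.Opens}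
    (m : CommRingCat.of K ⟶ Γ(Z, U)) (h : U.ι ≫ g = U.toSpecΓ ≫ Spec.map m) :
    scalarMap g U = m.hom := by
  have h1 := congr(($h).appTop)
  rw [Scheme.Hom.comp_appTop, Scheme.Hom.comp_appTop, Scheme.Opens.toSpecΓ_appTop,
    Scheme.ΓSpecIso_naturality_assoc] at h1
  have h2 : U.ι.appTop = Z.presheaf.map (homOfLE (le_top : U ≤ ⊤)).op ≫ U.topIso.inv := by
    rw [Iso.eq_comp_inv]
    simp only [Scheme.Opens.topIso, Scheme.Opens.ι_appTop]
    exact (Functor.map_comp _ _ _).symm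
  rw [h2, ← Category.assoc, ← Category.assoc, cancel_mono, ← Iso.inv_comp_eq] at h1
  rw [scalarMap_eq, h1]

theorem scalarMap_comp {Y : Scheme.{0}} (φ : Z ⟶ Y) (g : Y ⟶ Spec (.of K)) (U : Y.Opens) (a : K) :
    scalarMap (φ ≫ g) (φ ⁻¹ᵁ U) a = (φ.app U).hom (scalarMap g U a) := by
  have : (Scheme.ΓSpecIso (.of K)).inv ≫ (φ ≫ g).appTop ≫
      Z.presheaf.map (homOfLE (le_top : φ ⁻¹ᵁ U ≤ ⊤)).op =
      ((Scheme.ΓSpecIso (.of K)).inv ≫ g.appTop ≫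
        Y.presheaf.map (homOfLE (le_top : U ≤ ⊤)).op) ≫ φ.app U := by
    rw [Scheme.Hom.comp_appTop]
    simp only [Category.assoc, Scheme.Hom.naturality]
    rfl
  exact congr(($this).hom a)

theorem scalarMap_comp_specMap {k : Type} [Field k] (c : k →+* K) (g : Z ⟶ Spec (.of K))
    (U : Z.Opens) (a : k) :
    scalarMap (g ≫ Spec.map (CommRingCat.ofHom c)) U a = scalarMap g U (c a) := by
  have : (Scheme.ΓSpecIso (.of k)).inv ≫
        (g ≫ Spec.map (CommRingCat.ofHom c)).appTop ≫
          Z.presheaf.map (homOfLE (le_top : U ≤ ⊤)).op =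
      CommRingCat.ofHom c ≫ (Scheme.ΓSpecIso (.of K)).inv ≫ g.appTop ≫
          Z.presheaf.map (homOfLE (le_top : U ≤ ⊤)).op := by
    rw [Scheme.Hom.comp_appTop, Scheme.ΓSpecIso_inv_naturality_assoc, Category.assoc]
  exact congr(($this).hom a)

theorem evaluation_scalarMap (g : Z ⟶ Spec (.of K)) (U : Z.Opens) (z : Z) (hz : z ∈ U) (a : K) :
    Z.evaluation U z hz (scalarMap g U a) =
      (Spec.preimage (Z.fromSpecResidueField z ≫ g)).hom a := by
  have h1 := congr(Scheme.Hom.appTop $(Spec.map_preimage (Z.fromSpecResidueField z ≫ g)))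
  rw [Scheme.fromSpecResidueField, Category.assoc, Scheme.Hom.comp_appTop,
    Scheme.Hom.comp_appTop, Scheme.fromSpecStalk_appTop] at h1
  have : ((Scheme.ΓSpecIso (.of K)).inv ≫ g.appTop ≫
      Z.presheaf.map (homOfLE (le_top : U ≤ ⊤)).op) ≫ Z.evaluation U z hz =
      Spec.preimage (Z.fromSpecResidueField z ≫ g) := by
    rw [← cancel_mono (Scheme.ΓSpecIso _).inv,
      Scheme.ΓSpecIso_inv_naturality (Spec.preimage _), Scheme.fromSpecResidueField,
      Category.assoc (Spec.map _), h1, ← Scheme.germ_residue]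
    simp [Scheme.ΓSpecIso_inv_naturality]
  exact congr(($this).hom a)

/-- The residue field of a closed point of a scheme locally of finite type over an algebraically
closed field is the base field. -/
theorem evaluation_scalarMap_bijective [IsAlgClosed K] (g : Z ⟶ Spec (.of K))
    [LocallyOfFiniteType g] (U : Z.Opens) (z : Z) (hz : z ∈ U) (hcl : IsClosed {z}) :
    Function.Bijective ((Z.evaluation U z hz).hom.comp (scalarMap g U)) := by
  have : ⇑((Z.evaluation U z hz).hom.comp (scalarMap g U)) =
      ⇑(residueFieldIsoBase g z hcl).inv.hom := by
    ext a
    have : Spec.preimage (Z.fromSpecResidueField z ≫ g) = (residueFieldIsoBase g z hcl).inv :=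
      Spec.map_injective (by simp)
    exact (evaluation_scalarMap g U z hz a).trans congr(($this).hom a)
  rw [this]
  exact ConcreteCategory.bijective_of_isIso (residueFieldIsoBase g z hcl).inv

end ScalarMap

/-! ### Forms as functions on the standard charts -/

section ProjectiveSpace
variable {N : ℕ}
open HomogeneousLocalization

/-- The dehomogenization homomorphism to the degree zero part of the localization away from
`xᵢ`. -/
def toAway (i : Fin (N + 1)) :
    MvPolynomial (Fin (N + 1)) ℂ →+* Away (grading N) (MvPolynomial.X i) :=
  MvPolynomial.eval₂Hom ((fromZeroRingHom (grading N) _).comp (algebraMap ℂ (grading N 0)))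
    fun j ↦ Away.mk (grading N) (X_mem_grading i) 1 (MvPolynomial.X j)
      (by rw [one_smul]; exact X_mem_grading j)

theorem eval₂_mul_of_isHomogeneous {σ R S : Type*} [CommRing R] [CommRing S]
    (f : R →+* S) (a : σ → S) (u : S) {F : MvPolynomial σ R} {t : ℕ} (hF : F.IsHomogeneous t) :
    MvPolynomial.eval₂ f (fun j ↦ u * a j) F = u ^ t * MvPolynomial.eval₂ f a F := by
  simp only [MvPolynomial.eval₂_eq, Finset.mul_sum]
  refine Finset.sum_congr rfl fun d hd ↦ ?_
  have : ∑ i ∈ d.support, d i = t := by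
    have := hF (MvPolynomial.mem_support_iff.1 hd)
    simpa [Finsupp.weight_apply, Finsupp.sum] using this
  simp only [mul_pow, Finset.prod_mul_distrib, Finset.prod_pow_eq_pow_sum, this]
  ring

/-- In the full localization `xⱼ / xᵢ` is `y * xⱼ` with `y = 1 / xᵢ`, and homogeneity pulls out the
factor `y ^ t`. -/
theorem toAway_eq_mk (i : Fin (N + 1)) {F : MvPolynomial (Fin (N + 1)) ℂ} {t : ℕ}
    (hF : F ∈ grading N t) :
    toAway i F = Away.mk (grading N) (X_mem_grading i) t F (by simpa using hF) := by
  ext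
  let L := Localization.Away (MvPolynomial.X i : MvPolynomial (Fin (N + 1)) ℂ)
  let y : L := Localization.mk 1 ⟨MvPolynomial.X i, 1, by simp⟩
  have h1 : (algebraMap (Away (grading N) (MvPolynomial.X i)) L).comp (toAway i) =
      MvPolynomial.eval₂Hom (algebraMap ℂ L) (fun j ↦ y *
        algebraMap _ L (MvPolynomial.X j : MvPolynomial (Fin (N + 1)) ℂ)) := by
    refine MvPolynomial.ringHom_ext (fun a ↦ ?_) fun j ↦ ?_
    · simp only [toAway, RingHom.comp_apply, MvPolynomial.coe_eval₂Hom, MvPolynomial.eval₂_C]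
      change Localization.mk _ 1 = _
      rw [Localization.mk_one_eq_algebraMap,
        IsScalarTower.algebraMap_apply ℂ (MvPolynomial (Fin (N + 1)) ℂ) L]
      rfl
    · simp only [toAway, RingHom.comp_apply, MvPolynomial.coe_eval₂Hom, MvPolynomial.eval₂_X]
      refine (Away.val_mk _ _ (X_mem_grading i) _ _).trans ?_
      rw [← Localization.mk_one_eq_algebraMap, Localization.mk_mul]
      simp
  have h2 : MvPolynomial.eval₂ (algebraMap ℂ L)
      (fun j ↦ algebraMap _ L (MvPolynomial.X j : MvPolynomial (Fin (N + 1)) ℂ)) F =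
      algebraMap _ L F := by
    rw [IsScalarTower.algebraMap_eq ℂ (MvPolynomial (Fin (N + 1)) ℂ) L]
    refine (MvPolynomial.eval₂_comp_left _ _ _ F).symm.trans ?_
    rw [MvPolynomial.algebraMap_eq, MvPolynomial.eval₂_eta]
  refine congr($h1 F).trans ?_
  rw [MvPolynomial.coe_eval₂Hom, eval₂_mul_of_isHomogeneous _ _ _ hF, h2, Away.val_mk,
    ← Localization.mk_one_eq_algebraMap, Localization.mk_pow, Localization.mk_mul]
  simp only [one_pow, one_mul, mul_one]
  rfl

theorem isUnit_mapId_mk_iff {A σ : Type*} [CommRing A] [SetLike σ A] [AddSubgroupClass σ A]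
    (𝒜 : ℕ → σ) [GradedRing 𝒜] (x : ProjectiveSpectrum 𝒜) {f : A}
    (hx : f ∈ x.asHomogeneousIdeal.toIdeal.primeCompl) (z : NumDenSameDeg 𝒜 (.powers f)) :
    IsUnit (mapId 𝒜 (Submonoid.powers_le.mpr hx) (.mk z)) ↔ z.num.1 ∉ x.asHomogeneousIdeal := by
  have : mapId 𝒜 (Submonoid.powers_le.mpr hx) (.mk z) =
    .mk ⟨z.deg, z.num, z.den, Submonoid.powers_le.mpr hx z.den_mem⟩ := rfl
  rw [← HomogeneousLocalization.isUnit_iff_isUnit_val, this,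
    HomogeneousLocalization.val_mk, Localization.mk_eq_mk',
    IsLocalization.AtPrime.isUnit_mk'_iff]
  rfl

/-- A section vanishes at `q` exactly when its germ is not a unit. The stalk is a homogeneous
localization in which the denominator `xᵢ ^ t` is invertible, so only the numerator matters. -/
theorem evaluation_awayToSection_mk_eq_zero_iff (i : Fin (N + 1)) (q : ProjSpace N) (hq : q ∈ chart i)
    {F : MvPolynomial (Fin (N + 1)) ℂ} {t : ℕ} (hF : F ∈ grading N (t • 1)) :
    (ProjSpace N).evaluation (chart i) q hq ((Proj.awayToSection (grading N) (MvPolynomial.X i)).hom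
      (Away.mk (grading N) (X_mem_grading i) t F hF)) = 0 ↔ F ∈ q.asHomogeneousIdeal := by
  rw [Scheme.evaluation_eq_zero_iff_notMem_basicOpen, Scheme.mem_basicOpen _ _ _ hq]
  have h1 : (ProjSpace N).presheaf.germ (chart i) q hq
      ((Proj.awayToSection (grading N) (MvPolynomial.X i)).hom
      (Away.mk (grading N) (X_mem_grading i) t F hF)) =
      (Proj.stalkIso (grading N) q).inv.hom (HomogeneousLocalization.mapId (grading N)
        (Submonoid.powers_le.mpr hq) (Away.mk (grading N) (X_mem_grading i) t F hF)) :=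
    congr(($(ProjectiveSpectrum.Proj.awayToSection_germ (grading N) (MvPolynomial.X i) q hq)).hom
      (Away.mk (grading N) (X_mem_grading i) t F hF))
  rw [h1]
  refine Iff.trans (not_congr ((MulEquiv.isUnit_map
    (Proj.stalkIso (grading N) q).symm.commRingCatIsoToRingEquiv).trans ?_)) not_not
  exact isUnit_mapId_mk_iff (grading N) q hq _

theorem scalarMap_toSpec (i : Fin (N + 1)) (a : ℂ) : scalarMap (ProjSpace.toSpec N) (chart i) a =
    (Proj.awayToSection (grading N) (MvPolynomial.X i)).hom (toAway i (MvPolynomial.C a)) := by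
  have h := scalarMap_eq_of_ι_comp_eq (g := ProjSpace.toSpec N) (U := chart i)
    (CommRingCat.ofHom ((fromZeroRingHom (grading N) _).comp (algebraMap ℂ (grading N 0))) ≫
      Proj.awayToSection (grading N) (MvPolynomial.X i)) ?_
  · rw [h]
    simp [toAway]
  · have h1 := Proj.awayι_toSpecZero (grading N) (MvPolynomial.X i) (X_mem_grading i) one_pos
    rw [Proj.awayι, Category.assoc, Iso.inv_comp_eq] at h1
    rw [ProjSpace.toSpec, reassoc_of% h1, Proj.basicOpenIsoSpec_hom, Proj.basicOpenToSpec]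
    simp [← Spec.map_comp]

/-- Two ring homomorphisms are compared on constants, where `h` is needed, and on variables. -/
theorem restrictToChart_map {K : Type} [Field K] {Z : Scheme.{0}} {g : Z ⟶ Spec (.of K)}
    {φ : Z ⟶ ProjSpace N} {c : ℂ →+* K}
    (h : g ≫ Spec.map (CommRingCat.ofHom c) = φ ≫ ProjSpace.toSpec N) (i : Fin (N + 1))
    (F : MvPolynomial (Fin (N + 1)) ℂ) :
    restrictToChart g φ i (MvPolynomial.map c F) = (φ.app (chart i)).hom
      ((Proj.awayToSection (grading N) (MvPolynomial.X i)).hom (toAway i F)) := by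
  have : (restrictToChart g φ i).comp (MvPolynomial.map c) = (φ.app (chart i)).hom.comp
      ((Proj.awayToSection (grading N) (MvPolynomial.X i)).hom.comp (toAway i)) := by
    refine MvPolynomial.ringHom_ext (fun a ↦ ?_) fun j ↦ ?_
    · have h1 := scalarMap_comp φ (ProjSpace.toSpec N) (chart i) a
      rw [← h, scalarMap_comp_specMap, scalarMap_toSpec] at h1
      simpa [restrictToChart] using h1
    · simp [restrictToChart, coordRatio, toAway]
  exact congr($this F)

/-- A form with complex coefficients vanishes at a point, computed in any chart, if and only if it
belongs to the homogeneous prime ideal of the image of the point in projective space. -/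
theorem evaluation_restrictToChart_map_eq_zero_iff {K : Type} [Field K] {Z : Scheme.{0}}
    {g : Z ⟶ Spec (.of K)} {φ : Z ⟶ ProjSpace N} {c : ℂ →+* K}
    (h : g ≫ Spec.map (CommRingCat.ofHom c) = φ ≫ ProjSpace.toSpec N) (i : Fin (N + 1))
    {F : MvPolynomial (Fin (N + 1)) ℂ} {t : ℕ} (hF : F ∈ grading N t) (z : Z)
    (hz : z ∈ φ ⁻¹ᵁ chart i) :
    Z.evaluation (φ ⁻¹ᵁ chart i) z hz (restrictToChart g φ i (MvPolynomial.map c F)) = 0 ↔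
      F ∈ (φ z).asHomogeneousIdeal := by
  rw [restrictToChart_map h, toAway_eq_mk i hF]
  refine Iff.trans ?_ (evaluation_awayToSection_mk_eq_zero_iff i (φ z) hz (by simpa using hF))
  refine Iff.trans (Eq.congr_left (Scheme.evaluation_naturality_apply φ z hz _).symm) ?_
  exact map_eq_zero (φ.residueFieldMap z).hom

end ProjectiveSpace

/-! ### Separating points of `Proj` by homogeneous elements -/

section SeparatingForms

variable {A σ : Type*} [CommRing A] [SetLike σ A] [AddSubgroupClass σ A]
    (𝒜 : ℕ → σ) [GradedRing 𝒜]

theorem exists_homogeneous_mem_notMem {x y : ProjectiveSpectrum 𝒜}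
    (h : ¬ y.asHomogeneousIdeal ≤ x.asHomogeneousIdeal) :
    ∃ (d : ℕ) (G : A), G ∈ 𝒜 d ∧ G ∈ y.asHomogeneousIdeal ∧ G ∉ x.asHomogeneousIdeal := by
  classical
  obtain ⟨a, hay, hax⟩ := SetLike.not_le_iff_exists.1 h
  by_contra! H
  refine hax ?_
  rw [← DirectSum.sum_support_decompose 𝒜 a]
  exact sum_mem fun i _ ↦ H i _ (SetLike.coe_mem _) (y.asHomogeneousIdeal.isHomogeneous i hay)

/-- A point of `Proj` is separated by a form from finitely many points of which it is not a
specialization. -/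
theorem exists_homogeneous_separating {ι : Type*} (s : Finset ι) (y : ι → ProjectiveSpectrum 𝒜)
    (x : ProjectiveSpectrum 𝒜) (h : ∀ j ∈ s, ¬ (y j).asHomogeneousIdeal ≤ x.asHomogeneousIdeal) :
    ∃ (d : ℕ) (G : A), G ∈ 𝒜 d ∧ G ∉ x.asHomogeneousIdeal ∧
      ∀ j ∈ s, G ∈ (y j).asHomogeneousIdeal := by
  classical
  induction s using Finset.induction_on with
  | empty =>
    refine ⟨0, 1, SetLike.one_mem_graded 𝒜, fun h1 ↦ x.isPrime.ne_top ?_, by simp⟩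
    exact (Ideal.eq_top_iff_one _).2 h1
  | insert j s _ ih =>
    obtain ⟨d, G, hG, hGx, hGy⟩ := ih fun k hk ↦ h k (Finset.mem_insert_of_mem hk)
    obtain ⟨e, G', hG', hGy', hGx'⟩ :=
      exists_homogeneous_mem_notMem 𝒜 (h j (Finset.mem_insert_self j s))
    -- By primality the product stays outside `x`, while it vanishes at the new point and at all the
    -- old ones.
    refine ⟨e + d, G' * G, SetLike.mul_mem_graded hG' hG, fun h1 ↦ ?_, fun k hk ↦ ?_⟩
    · exact (x.isPrime.mem_or_mem h1).elim hGx' hGx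
    · obtain rfl | hk := Finset.mem_insert.1 hk
      · exact Ideal.mul_mem_right _ _ hGy'
      · exact Ideal.mul_mem_left _ _ (hGy k hk)

end SeparatingForms

/-! ### Hilbert functions of finite reduced and of nonempty schemes -/

section HilbertFunction

variable {K : Type} [Field K] {N : ℕ} {Z : Scheme.{0}}

theorem exists_mem_chart (q : ProjSpace N) : ∃ i : Fin (N + 1), q ∈ chart i := by
  have h := Proj.iSup_basicOpen_eq_top (grading N)
    (fun i : Fin (N + 1) ↦ (MvPolynomial.X i : MvPolynomial (Fin (N + 1)) ℂ)) ?_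
  · have : q ∈ (⊤ : (ProjSpace N).Opens) := trivial
    rw [← h] at this
    simpa using this
  -- An element of the irrelevant ideal has no constant term, so each of its monomials involves a
  -- variable.
  · intro F hF
    rw [← Set.image_univ, MvPolynomial.mem_ideal_span_X_image]
    intro m hm
    by_contra! hm0
    obtain rfl : m = 0 := Finsupp.ext fun j ↦ hm0 j trivial
    have h0 := (HomogeneousIdeal.mem_irrelevant_iff _ _).1 hF
    rw [GradedRing.proj_apply] at h0
    replace h0 : MvPolynomial.homogeneousComponent 0 F = 0 :=
      (MvPolynomial.decomposition.decompose'_apply F 0).symm.trans h0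
    refine MvPolynomial.mem_support_iff.1 hm ?_
    have := congr(MvPolynomial.coeff 0 $h0)
    simpa [MvPolynomial.coeff_homogeneousComponent] using this

theorem coordRatio_self (i : Fin (N + 1)) : coordRatio i i = 1 := by
  have : HomogeneousLocalization.Away.mk (grading N) (X_mem_grading i) 1
      (MvPolynomial.X i) (by rw [one_smul]; exact X_mem_grading i) = 1 := by
    ext
    rw [HomogeneousLocalization.Away.val_mk, HomogeneousLocalization.val_one]
    simp only [pow_one]
    exact Localization.mk_self (⟨MvPolynomial.X i, 1, by simp⟩ :
      Submonoid.powers (MvPolynomial.X i : MvPolynomial (Fin (N + 1)) ℂ))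
  rw [coordRatio, this, map_one]

theorem finite_homogeneousSubmodule {σ R : Type*} [Finite σ] [Field R] (t : ℕ) :
    Module.Finite R (MvPolynomial.homogeneousSubmodule σ R t) :=
  Module.Finite.iff_fg.2 (MvPolynomial.homogeneousSubmodule_fg σ R t)

/-- On a reduced scheme a section is zero once it vanishes at every point, and the charts cover `Z`.
-/
theorem mem_vanishingForms_iff [IsReduced Z] {g : Z ⟶ Spec (.of K)} {φ : Z ⟶ ProjSpace N}
    {c : ℂ →+* K} (h : g ≫ Spec.map (CommRingCat.ofHom c) = φ ≫ ProjSpace.toSpec N) {t : ℕ}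
    (F : MvPolynomial.homogeneousSubmodule (Fin (N + 1)) K t)
    {G : MvPolynomial (Fin (N + 1)) ℂ} (hG : G ∈ grading N t) (hF : MvPolynomial.map c G = F) :
    F ∈ vanishingForms g φ t ↔ ∀ z : Z, G ∈ (φ z).asHomogeneousIdeal := by
  have h1 (i) : restrictToChart g φ i (F : MvPolynomial (Fin (N + 1)) K) = 0 ↔
      ∀ (z : Z), z ∈ φ ⁻¹ᵁ chart i → G ∈ (φ z).asHomogeneousIdeal := by
    rw [← basicOpen_eq_bot_iff, Scheme.basicOpen_eq_bot_iff_forall_evaluation_eq_zero,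
      Subtype.forall, ← hF]
    exact forall₂_congr fun z hz ↦ evaluation_restrictToChart_map_eq_zero_iff h i hG z hz
  refine (forall_congr' h1).trans ⟨fun H z ↦ ?_, fun H i z _ ↦ H z⟩
  obtain ⟨i, hi⟩ := exists_mem_chart (φ z)
  exact H i z hi

/-- The value at a rational point `z` of the dehomogenization of a form with respect to `xᵢ`. -/
def evalAtPoint (g : Z ⟶ Spec (.of K)) (φ : Z ⟶ ProjSpace N) (t : ℕ) (i : Fin (N + 1)) (z : Z)
    (hz : z ∈ φ ⁻¹ᵁ chart i) (hb : Function.Bijective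
      ((Z.evaluation (φ ⁻¹ᵁ chart i) z hz).hom.comp (scalarMap g (φ ⁻¹ᵁ chart i)))) :
    MvPolynomial.homogeneousSubmodule (Fin (N + 1)) K t →ₗ[K] K where
  toFun F := (RingEquiv.ofBijective _ hb).symm
    (Z.evaluation (φ ⁻¹ᵁ chart i) z hz (restrictToChart g φ i F))
  map_add' F G := by simp
  map_smul' a F := by
    simp only [Submodule.coe_smul, MvPolynomial.smul_eq_C_mul, map_mul, RingHom.id_apply,
      smul_eq_mul]
    congr 1
    rw [RingEquiv.symm_apply_eq]
    simp [restrictToChart]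

theorem evalAtPoint_eq_zero_iff {g : Z ⟶ Spec (.of K)} {φ : Z ⟶ ProjSpace N}
    {c : ℂ →+* K} (h : g ≫ Spec.map (CommRingCat.ofHom c) = φ ≫ ProjSpace.toSpec N) {t : ℕ}
    (F : MvPolynomial.homogeneousSubmodule (Fin (N + 1)) K t)
    {G : MvPolynomial (Fin (N + 1)) ℂ} (hG : G ∈ grading N t) (hF : MvPolynomial.map c G = F)
    {i : Fin (N + 1)} {z : Z} {hz : z ∈ φ ⁻¹ᵁ chart i} {hb} :
    evalAtPoint g φ t i z hz hb F = 0 ↔ G ∈ (φ z).asHomogeneousIdeal := by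
  rw [← evaluation_restrictToChart_map_eq_zero_iff h i hG z hz, hF]
  exact map_eq_zero_iff _ (RingEquiv.injective _)

/-- The Hilbert function of a finite reduced scheme over an algebraically closed field is
eventually the number of points. -/
theorem eventually_hilbertFunction_eq_card [IsAlgClosed K] [IsReduced Z] [Fintype Z]
    {g : Z ⟶ Spec (.of K)} [LocallyOfFiniteType g] (hZ : ∀ z : Z, IsClosed {z})
    {φ : Z ⟶ ProjSpace N} {c : ℂ →+* K} (hc : Function.Surjective c)
    (h : g ≫ Spec.map (CommRingCat.ofHom c) = φ ≫ ProjSpace.toSpec N)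
    (hφ : ∀ z w : Z, (φ z).asHomogeneousIdeal ≤ (φ w).asHomogeneousIdeal → z = w) :
    ∀ᶠ t : ℕ in Filter.atTop, hilbertFunction g φ t = Fintype.card Z := by
  classical
  choose i hi using fun z : Z ↦ exists_mem_chart (φ z)
  choose d G hG hGz hGw using fun z : Z ↦ exists_homogeneous_separating (grading N)
    (Finset.univ.erase z) φ (φ z) fun w hw hle ↦ Finset.ne_of_mem_erase hw (hφ _ _ hle)
  -- From here on `t` is at least the degree of every separating form.
  filter_upwards [Filter.eventually_ge_atTop (Finset.univ.sup d)] with t ht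
  let Φ : MvPolynomial.homogeneousSubmodule (Fin (N + 1)) K t →ₗ[K] (Z → K) :=
    LinearMap.pi fun z ↦ evalAtPoint g φ t (i z) z (hi z)
      (evaluation_scalarMap_bijective g _ z (hi z) (hZ z))
  have hker : LinearMap.ker Φ = vanishingForms g φ t := by
    ext F
    obtain ⟨G, hGF⟩ := MvPolynomial.map_surjective c hc (F : MvPolynomial (Fin (N + 1)) K)
    have hG : G ∈ grading N t := by
      refine MvPolynomial.IsHomogeneous.of_map c.injective (φ := G) ?_
      rw [hGF]
      exact F.2
    rw [mem_vanishingForms_iff h F hG hGF, LinearMap.mem_ker, funext_iff]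
    exact forall_congr' fun z ↦ evalAtPoint_eq_zero_iff h F hG hGF
  -- A power of the coordinate `X (i z)`, nonzero at `z`, raises the separating form to the common
  -- degree `t`.
  have hmem (z : Z) : MvPolynomial.X (i z) ^ (t - d z) * G z ∈ grading N t := by
    have h1 := SetLike.mul_mem_graded (SetLike.pow_mem_graded (t - d z) (X_mem_grading (i z)))
      (hG z)
    rwa [smul_eq_mul, mul_one,
      Nat.sub_add_cancel ((Finset.le_sup (Finset.mem_univ z)).trans ht)] at h1
  let H (z : Z) : MvPolynomial.homogeneousSubmodule (Fin (N + 1)) K t :=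
    ⟨MvPolynomial.map c (MvPolynomial.X (i z) ^ (t - d z) * G z),
      MvPolynomial.IsHomogeneous.map (hmem z) c⟩
  have hHne (z : Z) : Φ (H z) z ≠ 0 := by
    refine (evalAtPoint_eq_zero_iff h (H z) (hmem z) rfl).not.2 fun h1 ↦ ?_
    exact ((φ z).isPrime.mem_or_mem h1).elim
      (fun h2 ↦ hi z ((φ z).isPrime.mem_of_pow_mem _ h2)) (hGz z)
  have hHzero (z w : Z) (hzw : w ≠ z) : Φ (H z) w = 0 :=
    (evalAtPoint_eq_zero_iff h (H z) (hmem z) rfl).2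
      (Ideal.mul_mem_left _ _ (hGw z w (by simp [hzw])))
  have hsurj : Function.Surjective Φ := by
    intro v
    refine ⟨∑ z, (v z / Φ (H z) z) • H z, funext fun w ↦ ?_⟩
    rw [map_sum, Finset.sum_apply, Finset.sum_eq_single w]
    · simp [div_mul_cancel₀ _ (hHne w)]
    · intro z _ hz
      simp [hHzero z w hz.symm]
    · simp
  rw [hilbertFunction, ← hker, (Φ.quotKerEquivOfSurjective hsurj).finrank_eq,
    Module.finrank_fintype_fun_eq_card]

/-- The Hilbert function of a nonempty scheme is positive. -/
theorem hilbertFunction_pos [Nonempty Z] (g : Z ⟶ Spec (.of K)) (φ : Z ⟶ ProjSpace N) (t : ℕ) :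
    0 < hilbertFunction g φ t := by
  have := finite_homogeneousSubmodule (σ := Fin (N + 1)) (R := K) t
  obtain ⟨z⟩ := ‹Nonempty Z›
  obtain ⟨i, hi⟩ := exists_mem_chart (φ z)
  have hne : vanishingForms g φ t ≠ ⊤ := by
    intro htop
    have h1 : (⟨MvPolynomial.X i ^ t, by simpa using (MvPolynomial.isHomogeneous_X K i).pow t⟩ :
        MvPolynomial.homogeneousSubmodule (Fin (N + 1)) K t) ∈ vanishingForms g φ t :=
      htop ▸ Submodule.mem_top
    have h2 := h1 i
    simp only [map_pow, restrictToChart, MvPolynomial.coe_eval₂Hom, MvPolynomial.eval₂_X,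
      coordRatio_self, map_one, one_pow] at h2
    have : Nonempty (φ ⁻¹ᵁ chart i) := ⟨⟨z, hi⟩⟩
    exact one_ne_zero h2
  have := Submodule.Quotient.nontrivial_iff.2 hne
  exact Module.finrank_pos

end HilbertFunction

/-! ### Reduced structures, the point `Spec K`, and closed points -/

instance isReduced_subscheme_vanishingIdeal {X : Scheme.{0}} (A : TopologicalSpace.Closeds X) :
    IsReduced (Scheme.IdealSheafData.vanishingIdeal A).subscheme := by
  let I := Scheme.IdealSheafData.vanishingIdeal A
  let 𝒰 := I.subschemeCover.openCover
  have (i : X.affineOpens) : IsReduced (𝒰.X i) := by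
    have h : (I.ideal i).IsRadical := PrimeSpectrum.isRadical_vanishingIdeal _
    have := (Ideal.isRadical_iff_quotient_reduced _).1 h
    exact (affine_isReduced_iff (.of (Γ(X, i.1) ⧸ I.ideal i))).2 this
  exact @IsReduced.of_openCover _ 𝒰 this

instance isIso_fromSpecResidueField {K : Type} [Field K] (s : Spec (.of K)) :
    IsIso ((Spec (.of K)).fromSpecResidueField s) := by
  have : IsClosedImmersion ((Spec (.of K)).fromSpecResidueField s) :=
    isClosed_singleton_iff_isClosedImmersion.1 (T1Space.t1 (X := PrimeSpectrum K) s)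
  have : Surjective ((Spec (.of K)).fromSpecResidueField s) :=
    ⟨fun y ↦ ⟨IsLocalRing.closedPoint _, Subsingleton.elim (α := PrimeSpectrum K) _ _⟩⟩
  exact isIso_of_isClosedImmersion_of_surjective _

/-- A finite set of closed points is closed; in a Jacobson space it is also dense, so it would be
everything. A finite `T1` space is discrete, of dimension at most zero. -/
theorem infinite_closedPoints_of_topologicalKrullDim_pos {X : Type*} [TopologicalSpace X]
    [JacobsonSpace X] (h : 0 < topologicalKrullDim X) : (closedPoints X).Infinite := by
  intro hfin
  have hcl : IsClosed (closedPoints X) := by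
    rw [← Set.biUnion_of_singleton (closedPoints X)]
    exact hfin.isClosed_biUnion fun x hx ↦ hx
  have huniv : closedPoints X = Set.univ := by
    rw [← hcl.closure_eq, closure_closedPoints]
  have : Finite X := Set.finite_univ_iff.1 (huniv ▸ hfin)
  have : T1Space X := ⟨fun x ↦ huniv.ge (Set.mem_univ x)⟩
  exact h.not_ge (topologicalKrullDim_zero_of_discreteTopology X)

/-! ### Closed points of the curve and fibres of families -/

namespace SmoothProjectiveCurve

variable (C : SmoothProjectiveCurve)

instance locallyOfFiniteType_str : LocallyOfFiniteType C.str := by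
  have := C.smooth
  unfold str
  infer_instance

theorem infinite_closedPoints : (closedPoints C.X).Infinite := by
  have : JacobsonSpace C.X := LocallyOfFiniteType.jacobsonSpace C.str
  exact infinite_closedPoints_of_topologicalKrullDim_pos (by rw [C.dim_eq_one]; exact one_pos)

section Family

variable {S : Scheme.{0}} {σ : S ⟶ Spec (.of ℂ)} (I : (C.prod σ).IdealSheafData)

instance locallyOfFiniteType_fibreStr (s : S) : LocallyOfFiniteType (C.fibreStr I s) := by
  have : LocallyOfFiniteType (C.familyMap I) := by
    unfold familyMap
    infer_instance
  exact inferInstanceAs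
    (LocallyOfFiniteType (pullback.snd (C.familyMap I) (S.fromSpecResidueField s)))

theorem fibreStr_comp (s : S) : C.fibreStr I s ≫ S.fromSpecResidueField s ≫ σ =
    C.fibreToProjSpace I s ≫ ProjSpace.toSpec C.N := by
  have h1 := (C.familyMap I).fiber_fac s
  have h2 : pullback.fst C.str σ ≫ C.ι ≫ ProjSpace.toSpec C.N = pullback.snd C.str σ ≫ σ :=
    pullback.condition
  have h3 : (C.familyMap I).fiberToSpecResidueField s ≫ S.fromSpecResidueField s ≫ σ =
      ((C.familyMap I).fiberι s ≫ I.subschemeι ≫ pullback.fst C.str σ ≫ C.ι) ≫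
        ProjSpace.toSpec C.N := by
    rw [← reassoc_of% h1, familyMap]
    simp only [Category.assoc, h2]
  exact h3

end Family

/-! ### Families over `Spec ℂ` given by finitely many closed points -/

section Point

variable (I : (C.prod (𝟙 (Spec (.of ℂ)))).IdealSheafData)

instance isIso_fiberι (s : Spec (.of ℂ)) : IsIso ((C.familyMap I).fiberι s) := by
  have := isIso_fromSpecResidueField s
  exact MorphismProperty.pullback_fst (P := MorphismProperty.isomorphisms Scheme) _ _ this

instance isClosedImmersion_fibreToProjSpace (s : Spec (.of ℂ)) :
    IsClosedImmersion (C.fibreToProjSpace I s) := by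
  have := C.isClosedImmersion
  have h := C.isIso_fiberι I s
  have : IsClosedImmersion (I.subschemeι ≫ pullback.fst C.str (𝟙 (Spec (.of ℂ))) ≫ C.ι) :=
    inferInstance
  exact IsClosedImmersion.comp ((C.familyMap I).fiberι s) _

theorem isHilbertFamily_vanishingIdeal {n : ℕ} (hn : 0 < n)
    (A : TopologicalSpace.Closeds (C.prod (𝟙 (Spec (.of ℂ))))) (hA : ∀ x ∈ A, IsClosed {x})
    (hcard : (A : Set (C.prod (𝟙 (Spec (.of ℂ))))).ncard = n) :
    C.IsHilbertFamily (.vanishingIdeal A) (constPoly n) := by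
  let I := Scheme.IdealSheafData.vanishingIdeal A
  have hrange (s) : Set.range ((C.familyMap I).fiberι s ≫ I.subschemeι) = A := by
    rw [Scheme.Hom.comp_base, TopCat.coe_comp, Set.range_comp,
      Set.range_eq_univ.2 ((C.familyMap I).fiberι s).surjective, Set.image_univ,
      Scheme.IdealSheafData.range_subschemeι]
    exact Scheme.IdealSheafData.coe_support_vanishingIdeal A
  have hinj (s) : Function.Injective ((C.familyMap I).fiberι s ≫ I.subschemeι) :=
    Scheme.Hom.injective _
  -- An infinite set has `ncard` zero, so `0 < n` yields finiteness too.
  have hfin : (A : Set (C.prod (𝟙 (Spec (.of ℂ))))).Finite :=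
    Set.finite_of_ncard_pos (hcard ▸ hn)
  refine ⟨inferInstance, fun s ↦ ?_, fun s ↦ ?_⟩
  · obtain ⟨x, hx⟩ := Set.nonempty_of_ncard_ne_zero (hcard ▸ hn.ne')
    rw [← hrange s] at hx
    exact ⟨hx.choose⟩
  -- The residue field at the point of `Spec ℂ` is only isomorphic to `ℂ`; `c` transports algebraic
  -- closedness to it.
  · let c := Spec.preimage ((Spec (.of ℂ)).fromSpecResidueField s)
    have hc : Function.Bijective c.hom := by
      rw [← isIso_SpecMap_iff, Spec.map_preimage]
      exact isIso_fromSpecResidueField s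
    have : IsAlgClosed ((Spec (.of ℂ)).residueField s) :=
      IsAlgClosed.of_ringEquiv ℂ _ (RingEquiv.ofBijective c.hom hc)
    have : Finite (C.fibre I s) := by
      have := hfin.to_subtype
      exact Finite.of_injective (fun z ↦ (⟨_, (hrange s).le ⟨z, rfl⟩⟩ : A)) fun z w h ↦
        hinj s congr(($h).1)
    have : IsReduced (C.fibre I s) :=
      have h : IsOpenImmersion ((C.familyMap I).fiberι s) :=
        @IsOpenImmersion.of_isIso _ _ _ (C.isIso_fiberι I s)
      @isReduced_of_isOpenImmersion _ _ _ h (isReduced_subscheme_vanishingIdeal A)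
    have := Fintype.ofFinite (C.fibre I s)
    have hcl (z : C.fibre I s) : IsClosed {z} := by
      have h1 := (hA _ ((hrange s).le ⟨z, rfl⟩)).preimage
        ((C.familyMap I).fiberι s ≫ I.subschemeι).continuous
      have h2 : ({z} : Set (C.fibre I s)) = ⇑((C.familyMap I).fiberι s ≫ I.subschemeι) ⁻¹'
          {((C.familyMap I).fiberι s ≫ I.subschemeι) z} :=
        Set.ext fun w ↦ (hinj s).eq_iff.symm
      rw [h2]
      exact h1
    have hcardZ : Fintype.card (C.fibre I s) = n := by
      rw [← hcard, ← hrange s, ← Set.image_univ, Set.ncard_image_of_injective _ (hinj s),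
        Set.ncard_univ, ← Nat.card_eq_fintype_card]
      rfl
    -- Inclusion of homogeneous primes is specialization, and the image of `z` is a closed point.
    have hφ (z w : C.fibre I s) (h : (C.fibreToProjSpace I s z).asHomogeneousIdeal ≤
        (C.fibreToProjSpace I s w).asHomogeneousIdeal) : z = w := by
      have h1 := ((C.fibreToProjSpace I s).isClosedEmbedding.isClosedMap _ (hcl z))
      have h2 := (ProjectiveSpectrum.le_iff_mem_closure (grading C.N) _ _).1 h
      rw [Set.image_singleton] at h1
      have h3 := h1.closure_eq.le h2
      exact ((C.fibreToProjSpace I s).isClosedEmbedding.injective h3).symm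
    have hcompat : C.fibreStr I s ≫ Spec.map (CommRingCat.ofHom c.hom) =
        C.fibreToProjSpace I s ≫ ProjSpace.toSpec C.N := by
      rw [← fibreStr_comp, Category.comp_id]
      exact congrArg _ (Spec.map_preimage _)
    have key := eventually_hilbertFunction_eq_card hcl hc.2 hcompat hφ
    filter_upwards [key] with t ht
    rw [ht, hcardZ]
    simp [constPoly]

theorem hilbNonempty_constPoly {n : ℕ} (hn : 0 < n) : C.HilbNonempty (constPoly n) := by
  obtain ⟨B, hB, hcard⟩ := C.infinite_closedPoints.exists_subset_card_eq n
  -- As a base change of the identity, `p` is an isomorphism, so points of `C` can be moved to the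
  -- product.
  let p := pullback.fst C.str (𝟙 (Spec (.of ℂ)))
  let e := p.homeomorph
  have hBcl (x) (hx : x ∈ e ⁻¹' (B : Set C.X)) : IsClosed {x} := by
    have h1 := (show IsClosed {e x} from hB hx).preimage e.continuous
    rwa [← Set.image_singleton, Set.preimage_image_eq _ e.injective] at h1
  have hfin : (e ⁻¹' (B : Set C.X)).Finite := B.finite_toSet.preimage e.injective.injOn
  refine ⟨Spec (.of ℂ), 𝟙 _, .vanishingIdeal ⟨e ⁻¹' (B : Set C.X), ?_⟩, ?_, inferInstance,
    C.isHilbertFamily_vanishingIdeal hn _ hBcl ?_⟩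
  · rw [← Set.biUnion_of_singleton (e ⁻¹' (B : Set C.X))]
    exact hfin.isClosed_biUnion hBcl
  · infer_instance
  · rw [TopologicalSpace.Closeds.coe_mk, Set.ncard_preimage_of_injective_subset_range e.injective
      (by simp [e.surjective.range_eq]), Set.ncard_coe_finset, hcard]

end Point

/-! ### Positivity of Hilbert polynomials and good partitions -/

/-- A Hilbert polynomial of a nonempty closed subscheme has positive values in large degrees,
which are natural numbers. -/
theorem HilbNonempty.eventually_eval {C : SmoothProjectiveCurve} {P : Polynomial ℚ}
    (h : C.HilbNonempty P) :
    ∀ᶠ t : ℕ in Filter.atTop, ∃ m : ℕ, 0 < m ∧ P.eval (t : ℚ) = m := by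
  obtain ⟨S, σ, I, -, ⟨s⟩, hI⟩ := h
  have := hI.nonempty_fibre s
  filter_upwards [hI.hasHilbertPolynomial s] with t ht
  exact ⟨_, hilbertFunction_pos _ _ t, ht.symm⟩

theorem hilbNonempty_constPoly_iff (k : ℤ) : C.HilbNonempty (constPoly k) ↔ 0 < k := by
  constructor
  · intro h
    obtain ⟨t, m, hm, ht⟩ := h.eventually_eval.exists
    rw [constPoly, Polynomial.eval_C] at ht
    have : k = m := by exact_mod_cast ht
    omega
  · intro hk
    lift k to ℕ using hk.le
    exact C.hilbNonempty_constPoly (by exact_mod_cast hk)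

end SmoothProjectiveCurve

/-- A polynomial which is bounded on large natural numbers is constant. -/
theorem eq_C_of_eventually_eval_mem_Icc (P : Polynomial ℚ) (a b : ℚ)
    (h : ∀ᶠ t : ℕ in Filter.atTop, P.eval (t : ℚ) ∈ Set.Icc a b) :
    ∃ r, P = Polynomial.C r := by
  refine ⟨P.coeff 0, Polynomial.eq_C_of_degree_le_zero (le_of_not_gt fun hdeg ↦ ?_)⟩
  have h1 := (P.abs_tendsto_atTop hdeg).comp (tendsto_natCast_atTop_atTop (R := ℚ))
  obtain ⟨t, ht, ht'⟩ := (h.and (h1.eventually_gt_atTop (max |a| |b|))).exists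
  exact absurd (abs_le_max_abs_abs ht.1 ht.2) (not_le.2 ht')

theorem isPartition_of_isGoodPartition {C : SmoothProjectiveCurve} {n s : ℕ}
    {Q : Fin s → Polynomial ℚ} (h : C.IsGoodPartition (constPoly n) Q) :
    ∃ m : Fin s → ℕ, IsPartition n m ∧ ∀ i, Q i = constPoly (m i) := by
  have hev := Filter.eventually_all.2 fun i ↦ (h.2 i).eventually_eval
  have hsum (t : ℕ) : ∑ i, (Q i).eval (t : ℚ) = n := by
    rw [← Polynomial.eval_finsetSum, h.1]
    simp [constPoly]
  have hconst (i) : ∃ r, Q i = Polynomial.C r := by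
    -- For large `t` all summands are nonnegative, so each is at most their sum `n`.
    refine eq_C_of_eventually_eval_mem_Icc (Q i) 0 n ?_
    filter_upwards [hev] with t ht
    have hnn (j) : 0 ≤ (Q j).eval (t : ℚ) := by
      obtain ⟨m, -, hm⟩ := ht j
      simp [hm]
    exact ⟨hnn i, (hsum t).symm ▸ Finset.single_le_sum (f := fun j ↦ (Q j).eval (t : ℚ))
      (fun j _ ↦ hnn j) (Finset.mem_univ i)⟩
  choose r hr using hconst
  -- The polynomials being constant, their values at one large `t` determine them.
  obtain ⟨t, ht⟩ := hev.exists
  choose m hm hmt using ht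
  have hQ (i) : Q i = constPoly (m i) := by
    have := hmt i
    rw [hr i, Polynomial.eval_C] at this
    rw [hr i, this, constPoly, Int.cast_natCast]
  refine ⟨m, ⟨?_, hm⟩, hQ⟩
  have := hsum t
  simp only [hmt] at this
  exact_mod_cast this

theorem isGoodPartition_of_isPartition (C : SmoothProjectiveCurve) {n s : ℕ} {m : Fin s → ℕ}
    (h : IsPartition n m) : C.IsGoodPartition (constPoly n) fun i ↦ constPoly (m i) := by
  refine ⟨?_, fun i ↦ C.hilbNonempty_constPoly (h.2 i)⟩
  simp [constPoly, ← h.1]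

end HilbertCurve

end

theorem lemma4p4 (C : HilbertCurve.SmoothProjectiveCurve) (n : ℕ) (hn : 0 < n) :
    -- every partition of `n` is a good partition of `n`
    (∀ (s : ℕ) (m : Fin s → ℕ), HilbertCurve.IsPartition n m →
      C.IsGoodPartition (HilbertCurve.constPoly n) fun i ↦ HilbertCurve.constPoly (m i)) ∧
    -- every good partition of `n` is a partition of `n`
    (∀ (s : ℕ) (Q : Fin s → Polynomial ℚ),
      C.IsGoodPartition (HilbertCurve.constPoly n) Q →
        ∃ m : Fin s → ℕ, HilbertCurve.IsPartition n m ∧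
          ∀ i, Q i = HilbertCurve.constPoly (m i)) ∧
    -- `Hilb_C^k` is nonempty precisely for positive `k`
    (∀ k : ℤ, C.HilbNonempty (HilbertCurve.constPoly k) ↔ 0 < k) :=
  ⟨fun _ _ h ↦ HilbertCurve.isGoodPartition_of_isPartition C h,
    fun _ _ h ↦ HilbertCurve.isPartition_of_isGoodPartition h, C.hilbNonempty_constPoly_iff⟩
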